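/- Let $G$ be a finite simple connected graph with $n$ vertices and $m$ edges that is not isomorphic to the star $K_{1,n-1}$ (where, for $n=1$, $K_{1,0}$ denotes the one-vertex graph). Let $L(G)=D(G)-A(G)$ be the Laplacian matrix of $G$, where $D(G)$ is the diagonal matrix of vertex degrees and $A(G)$ is the adjacency matrix, and let $\mu_1(G)\ge\mu_2(G)\ge\cdots\ge\mu_n(G)=0$ be its eigenvalues, counted with multiplicity. Then $$\mu_2(G)\ \ge\ \frac{2m}{n},$$ and equality holds if and only if $n$ is even and $G$ is isomorphic to the complete bipartite graph $K_{n/2,n/2}$. -/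

import Mathlib

/-- The `k`-th largest Laplacian eigenvalue of `G`, for `1 ≤ k ≤ |V|`, counted with multiplicity:
`laplacianEigenvalue G 1 ≥ laplacianEigenvalue G 2 ≥ ⋯`. It is set to `0` outside that range.
(`Matrix.IsHermitian.eigenvalues₀` is the nonincreasing list of eigenvalues, indexed from `0`.) -/
noncomputable def laplacianEigenvalue {V : Type*} [Fintype V] [DecidableEq V]
    (G : SimpleGraph V) [DecidableRel G.Adj] (k : ℕ) : ℝ :=
  if h : 1 ≤ k ∧ k ≤ Fintype.card V then
    (G.isHermitian_lapMatrix ℝ).eigenvalues₀ ⟨k - 1, by omega⟩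
  else 0

/-!
If `μ₂ ≤ a`, then `L(G) - a` is positive definite on no plane, so its quadratic form satisfies the
reversed Cauchy–Schwarz inequality on positive vectors. Take for `a` the average degree `2m/n`.

If some degree exceeds `a`, then planes supported near two vertices show that it is the degree of a
single vertex `u`, and testing an edge `vw` avoiding `u` gives
`(deg u - a)(deg v + deg w + 2 - 2a) ≤ 1`. With `k = ⌊a⌋ ≥ 2`, the neighbours other than `u` of a
vertex of degree `k` therefore have degree at most `k - 1`; double counting the edges at the
vertices of degree `k` makes the degrees fall short of `k` by at least `(n - 1)/2` in total.
This sharpens the edge bound to degrees at most `k - 2`, and the same count then gives a shortfall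
of `n - 1`, which forces `deg u ≥ n`.

Otherwise `G` is regular, and testing pairs of edges shows that the neighbourhoods of the ends of
each edge are complementary, so `G` is balanced complete bipartite.
-/

section CourantFischer

open Module RCLike InnerProductSpace

variable {𝕜 E F W : Type*} [RCLike 𝕜] [NormedAddCommGroup E] [InnerProductSpace 𝕜 E]
  [FiniteDimensional 𝕜 E] [AddCommGroup F] [Module 𝕜 F] [AddCommGroup W] [Module 𝕜 W]
  {T : E →ₗ[𝕜] E} {n : ℕ}

theorem exists_ne_zero_map_eq_zero {K M N : Type*} [DivisionRing K] [AddCommGroup M] [Module K M]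
    [AddCommGroup N] [Module K N] [FiniteDimensional K N] (g : M →ₗ[K] N)
    (h : finrank K N < finrank K M) : ∃ z, z ≠ 0 ∧ g z = 0 := by
  have : FiniteDimensional K M := .of_finrank_pos (by omega)
  obtain ⟨z, hz, hz0⟩ := (Submodule.ne_bot_iff _).1 (g.ker_ne_bot_of_finrank_lt h)
  exact ⟨z, hz0, hz⟩

theorem re_inner_apply_self_eq_sum_eigenvalues (hT : T.IsSymmetric) (hn : finrank 𝕜 E = n)
    (x : E) :
    re ⟪T x, x⟫_𝕜 =
      ∑ i, hT.eigenvalues hn i * ‖(hT.eigenvectorBasis hn).repr x i‖ ^ 2 := by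
  rw [← (hT.eigenvectorBasis hn).repr.inner_map_map, PiLp.inner_apply, map_sum]
  refine Finset.sum_congr rfl fun i _ => ?_
  rw [hT.eigenvectorBasis_apply_self_apply, ← smul_eq_mul, inner_smul_left, conj_ofReal,
    re_ofReal_mul, inner_self_eq_norm_sq]

/-- The coordinates of a vector along the eigenvectors of `T` with index in `s`. -/
noncomputable def eigenCoordinates (hT : T.IsSymmetric) (hn : finrank 𝕜 E = n)
    (s : Finset (Fin n)) : E →ₗ[𝕜] s → 𝕜 :=
  LinearMap.pi fun i => (hT.eigenvectorBasis hn).toBasis.coord i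

theorem exists_ne_zero_re_inner_le_eigenvalue (hT : T.IsSymmetric) (hn : finrank 𝕜 E = n)
    (k : Fin n) (f : F →ₗ[𝕜] E) (hF : (k : ℕ) < finrank 𝕜 F) :
    ∃ z, z ≠ 0 ∧ re ⟪T (f z), f z⟫_𝕜 ≤ hT.eigenvalues hn k * ‖f z‖ ^ 2 := by
  obtain ⟨z, hz0, hz⟩ := exists_ne_zero_map_eq_zero
    (eigenCoordinates hT hn (Finset.Iio k) ∘ₗ f)
    (by rwa [finrank_fintype_fun_eq_card, Fintype.card_coe, Fin.card_Iio])
  have hcoord : ∀ i < k, (hT.eigenvectorBasis hn).repr (f z) i = 0 := fun i hi => by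
    simpa [eigenCoordinates] using congr_fun hz ⟨i, by simpa using hi⟩
  refine ⟨z, hz0, ?_⟩
  rw [re_inner_apply_self_eq_sum_eigenvalues hT hn, ← (hT.eigenvectorBasis hn).repr.norm_map (f z),
    EuclideanSpace.norm_sq_eq, Finset.mul_sum]
  refine Finset.sum_le_sum fun i _ => ?_
  rcases lt_or_ge i k with hi | hi
  · simp [hcoord i hi]
  · exact mul_le_mul_of_nonneg_right (hT.eigenvalues_antitone hn hi) (sq_nonneg _)

theorem exists_ne_zero_eigenvalue_le_re_inner [FiniteDimensional 𝕜 W] (hT : T.IsSymmetric)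
    (hn : finrank 𝕜 E = n) (k : Fin n) (g : E →ₗ[𝕜] W) (hW : finrank 𝕜 W ≤ k) :
    ∃ x, x ≠ 0 ∧ g x = 0 ∧ hT.eigenvalues hn k * ‖x‖ ^ 2 ≤ re ⟪T x, x⟫_𝕜 := by
  obtain ⟨x, hx0, hx⟩ := exists_ne_zero_map_eq_zero
    (g.prod (eigenCoordinates hT hn (Finset.Ioi k))) (by
      rw [finrank_prod, finrank_fintype_fun_eq_card, Fintype.card_coe, Fin.card_Ioi, hn]
      omega)
  obtain ⟨hgx, hx⟩ := Prod.ext_iff.1 hx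
  have hcoord : ∀ i > k, (hT.eigenvectorBasis hn).repr x i = 0 := fun i hi => by
    simpa [eigenCoordinates] using congr_fun hx ⟨i, by simpa using hi⟩
  refine ⟨x, hx0, hgx, ?_⟩
  rw [re_inner_apply_self_eq_sum_eigenvalues hT hn, ← (hT.eigenvectorBasis hn).repr.norm_map x,
    EuclideanSpace.norm_sq_eq, Finset.mul_sum]
  refine Finset.sum_le_sum fun i _ => ?_
  rcases lt_or_ge k i with hi | hi
  · simp [hcoord i hi]
  · exact mul_le_mul_of_nonneg_right (hT.eigenvalues_antitone hn hi) (sq_nonneg _)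

end CourantFischer

section LaplacianForm

open Matrix Module

variable {V : Type*} [Fintype V] [DecidableEq V]

/-- The bilinear form of `L(G) - a`, whose sign on subspaces compares `a` with the Laplacian
eigenvalues. -/
noncomputable def shiftedLaplacianForm (G : SimpleGraph V) [DecidableRel G.Adj] (a : ℝ) :
    LinearMap.BilinForm ℝ (V → ℝ) :=
  toBilin' (G.lapMatrix ℝ - a • 1)

variable {G : SimpleGraph V} [DecidableRel G.Adj] {a : ℝ} {k : ℕ}

theorem shiftedLaplacianForm_ofLp_self (x : EuclideanSpace ℝ V) :
    shiftedLaplacianForm G a x.ofLp x.ofLp =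
      inner ℝ ((G.lapMatrix ℝ).toEuclideanLin x) x - a * ‖x‖ ^ 2 := by
  rw [shiftedLaplacianForm, toBilin'_apply', sub_mulVec, smul_mulVec, one_mulVec, dotProduct_sub,
    dotProduct_smul, smul_eq_mul, ← real_inner_self_eq_norm_sq]
  simp only [EuclideanSpace.inner_eq_star_dotProduct, star_trivial]
  rfl

theorem exists_ne_zero_shiftedLaplacianForm_nonpos {F : Type*} [AddCommGroup F] [Module ℝ F]
    (hk : 1 ≤ k) (hkV : k ≤ Fintype.card V) (ha : laplacianEigenvalue G k ≤ a)
    (f : F →ₗ[ℝ] V → ℝ) (hF : k ≤ finrank ℝ F) :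
    ∃ z, z ≠ 0 ∧ shiftedLaplacianForm G a (f z) (f z) ≤ 0 := by
  rw [laplacianEigenvalue, dif_pos ⟨hk, hkV⟩] at ha
  obtain ⟨z, hz0, hz⟩ := exists_ne_zero_re_inner_le_eigenvalue
    (isSymmetric_toEuclideanLin_iff.2 (G.isHermitian_lapMatrix ℝ)) finrank_euclideanSpace
    ⟨k - 1, by omega⟩ ((WithLp.linearEquiv 2 ℝ (V → ℝ)).symm ∘ₗ f) (by simp; omega)
  refine ⟨z, hz0, ?_⟩
  rw [← WithLp.ofLp_toLp 2 (f z), shiftedLaplacianForm_ofLp_self, sub_nonpos]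
  exact hz.trans (mul_le_mul_of_nonneg_right ha (sq_nonneg _))

theorem laplacianEigenvalue_le_of_shiftedLaplacianForm_nonpos {W : Type*} [AddCommGroup W]
    [Module ℝ W] [FiniteDimensional ℝ W] (hk : 1 ≤ k) (hkV : k ≤ Fintype.card V)
    (g : (V → ℝ) →ₗ[ℝ] W) (hW : finrank ℝ W < k)
    (hg : ∀ x, g x = 0 → shiftedLaplacianForm G a x x ≤ 0) : laplacianEigenvalue G k ≤ a := by
  obtain ⟨x, hx0, hgx, hx⟩ := exists_ne_zero_eigenvalue_le_re_inner
    (isSymmetric_toEuclideanLin_iff.2 (G.isHermitian_lapMatrix ℝ)) finrank_euclideanSpace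
    ⟨k - 1, by omega⟩ (g ∘ₗ (WithLp.linearEquiv 2 ℝ (V → ℝ)).toLinearMap) (by simp; omega)
  have hform := hg x.ofLp hgx
  rw [shiftedLaplacianForm_ofLp_self, sub_nonpos] at hform
  rw [laplacianEigenvalue, dif_pos ⟨hk, hkV⟩]
  exact le_of_mul_le_mul_right (hx.trans hform) (by positivity)

end LaplacianForm

section FormValues

open Matrix Module

variable {V : Type*} [Fintype V] [DecidableEq V] {G : SimpleGraph V} [DecidableRel G.Adj]
  {a : ℝ}

theorem isSymm_shiftedLaplacianForm : (shiftedLaplacianForm G a).IsSymm := by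
  refine ⟨fun x y => ?_⟩
  have hsymm : (G.lapMatrix ℝ - a • 1)ᵀ = G.lapMatrix ℝ - a • 1 := by
    rw [transpose_sub, (G.isSymm_lapMatrix (R := ℝ)).eq, transpose_smul, transpose_one]
  simp only [shiftedLaplacianForm, toBilin'_apply']
  rw [← dotProduct_transpose_mulVec, hsymm]

theorem shiftedLaplacianForm_single_single (v w : V) :
    shiftedLaplacianForm G a (Pi.single v 1) (Pi.single w 1) =
      (if v = w then (G.degree v : ℝ) - a else 0) - if G.Adj v w then 1 else 0 := by
  rw [shiftedLaplacianForm, toBilin'_single]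
  rcases eq_or_ne v w with rfl | h
  · simp [SimpleGraph.lapMatrix, SimpleGraph.degMatrix]
  · simp [SimpleGraph.lapMatrix, SimpleGraph.degMatrix, h]

theorem shiftedLaplacianForm_self (x : V → ℝ) :
    shiftedLaplacianForm G a x x =
      (∑ i, ∑ j, if G.Adj i j then (x i - x j) ^ 2 else 0) / 2 - a * ∑ i, x i ^ 2 := by
  rw [← G.lapMatrix_toLinearMap₂' ℝ, toLinearMap₂'_apply', shiftedLaplacianForm,
    toBilin'_apply', sub_mulVec, smul_mulVec, one_mulVec, dotProduct_sub, dotProduct_smul,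
    smul_eq_mul]
  simp only [dotProduct, sq]

theorem exists_ne_zero_shiftedLaplacianForm_combination_nonpos (hV : 2 ≤ Fintype.card V)
    (ha : laplacianEigenvalue G 2 ≤ a) (x y : V → ℝ) :
    ∃ z : ℝ × ℝ, z ≠ 0 ∧
      shiftedLaplacianForm G a (z.1 • x + z.2 • y) (z.1 • x + z.2 • y) ≤ 0 :=
  exists_ne_zero_shiftedLaplacianForm_nonpos one_le_two hV ha
    ((LinearMap.toSpanSingleton ℝ _ x).coprod (LinearMap.toSpanSingleton ℝ _ y)) (by simp)

end FormValues

section ReverseCauchySchwarz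

theorem mul_apply_self_le_sq_of_combination_nonpos {K M : Type*} [Field K] [LinearOrder K]
    [IsStrictOrderedRing K] [AddCommGroup M] [Module K M] {B : LinearMap.BilinForm K M}
    (hB : B.IsSymm) {x y : M} (hx : 0 < B x x) {z : K × K} (hz : z ≠ 0)
    (h : B (z.1 • x + z.2 • y) (z.1 • x + z.2 • y) ≤ 0) :
    B x x * B y y ≤ B x y ^ 2 := by
  obtain ⟨α, β⟩ := z
  simp only [map_add, map_smul, LinearMap.add_apply, LinearMap.smul_apply, smul_eq_mul,
    hB.eq y x] at h
  have hsq : (α * B x x + β * B x y) ^ 2 + β ^ 2 * (B x x * B y y - B x y ^ 2) ≤ 0 := by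
    have := mul_nonpos_of_nonneg_of_nonpos hx.le h
    linarith
  by_contra! hlt
  have hβ : β = 0 := by
    by_contra hβ
    have : 0 < β ^ 2 * (B x x * B y y - B x y ^ 2) := mul_pos (by positivity) (by linarith)
    linarith [sq_nonneg (α * B x x + β * B x y)]
  subst hβ
  have hα : α * B x x = 0 := by
    refine pow_eq_zero_iff two_ne_zero |>.1 (le_antisymm ?_ (sq_nonneg _))
    linarith
  exact hz (by simp [(mul_eq_zero.1 hα).resolve_right hx.ne'])

variable {V : Type*} [Fintype V] [DecidableEq V] {G : SimpleGraph V} [DecidableRel G.Adj]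
  {a : ℝ}

theorem shiftedLaplacianForm_mul_le_sq (hV : 2 ≤ Fintype.card V)
    (ha : laplacianEigenvalue G 2 ≤ a) {x : V → ℝ} (hx : 0 < shiftedLaplacianForm G a x x)
    (y : V → ℝ) :
    shiftedLaplacianForm G a x x * shiftedLaplacianForm G a y y ≤
      shiftedLaplacianForm G a x y ^ 2 := by
  obtain ⟨z, hz, h⟩ := exists_ne_zero_shiftedLaplacianForm_combination_nonpos hV ha x y
  exact mul_apply_self_le_sq_of_combination_nonpos isSymm_shiftedLaplacianForm hx hz h

theorem degree_le_of_not_adj {u v : V} (hne : u ≠ v) (h : ¬ G.Adj u v)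
    (ha : laplacianEigenvalue G 2 ≤ a) (hu : a < G.degree u) : (G.degree v : ℝ) ≤ a := by
  have hV : 2 ≤ Fintype.card V := Fintype.one_lt_card_iff.2 ⟨u, v, hne⟩
  have hmul := shiftedLaplacianForm_mul_le_sq hV ha (x := Pi.single u 1)
    (by simpa [shiftedLaplacianForm_single_single] using hu) (Pi.single v 1)
  simp only [shiftedLaplacianForm_single_single, hne, h, SimpleGraph.irrefl, if_true, if_false,
    sub_zero] at hmul
  nlinarith

theorem degree_sub_mul_edge_degree_le_one {u v w : V} (hv : v ≠ u) (hw : w ≠ u)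
    (hvw : G.Adj v w) (ha : laplacianEigenvalue G 2 ≤ a) (hu : a < G.degree u) :
    (G.degree u - a) * (G.degree v + G.degree w + 2 - 2 * a) ≤ 1 := by
  have hV : 2 ≤ Fintype.card V := Fintype.one_lt_card_iff.2 ⟨v, u, hv⟩
  have hmul := shiftedLaplacianForm_mul_le_sq hV ha (x := Pi.single u 1)
    (by simpa [shiftedLaplacianForm_single_single] using hu) (Pi.single v 1 - Pi.single w 1)
  simp only [map_sub, LinearMap.sub_apply, shiftedLaplacianForm_single_single, hv.symm, hw.symm,
    hvw, hvw.symm, hvw.ne, hvw.ne', SimpleGraph.irrefl, if_true, if_false] at hmul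
  have hcross : ((0 - if G.Adj u v then 1 else 0) - (0 - if G.Adj u w then 1 else 0) : ℝ) ^ 2
      ≤ 1 := by
    split_ifs <;> norm_num
  linarith

theorem four_le_sq_of_adj_of_adj {d : ℕ} (hreg : G.IsRegularOfDegree d)
    (hd : laplacianEigenvalue G 2 ≤ d) {p q r s : V} (hpq : G.Adj p q) (hrs : G.Adj r s) :
    4 ≤ (G.adjMatrix ℝ p r - G.adjMatrix ℝ p s - G.adjMatrix ℝ q r + G.adjMatrix ℝ q s) ^ 2 := by
  have hform : ∀ v w, shiftedLaplacianForm G d (Pi.single v 1) (Pi.single w 1) =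
      -G.adjMatrix ℝ v w := fun v w => by
    simp [shiftedLaplacianForm_single_single, hreg.degree_eq, SimpleGraph.adjMatrix_apply]
  have hedge : ∀ {v w}, G.Adj v w → shiftedLaplacianForm G d
      (Pi.single v 1 - Pi.single w 1) (Pi.single v 1 - Pi.single w 1) = 2 := fun h => by
    simp only [map_sub, LinearMap.sub_apply, hform]
    simp [h, h.symm]
    norm_num
  have hV : 2 ≤ Fintype.card V := Fintype.one_lt_card_iff.2 ⟨p, q, hpq.ne⟩
  have hmul := shiftedLaplacianForm_mul_le_sq hV hd (by rw [hedge hpq]; norm_num)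
    (Pi.single r 1 - Pi.single s 1)
  rw [hedge hpq, hedge hrs] at hmul
  simp only [map_sub, LinearMap.sub_apply, hform] at hmul
  linarith

end ReverseCauchySchwarz

section TwoLargeDegrees

open Finset

variable {V : Type*} [Fintype V] [DecidableEq V] {G : SimpleGraph V} [DecidableRel G.Adj]
  {u v : V}

theorem sum_eq_add_add_sum_compl_pair {M : Type*} [AddCommMonoid M] (h : u ≠ v) (g : V → M) :
    ∑ i, g i = g u + g v + ∑ i ∈ ({u, v} : Finset V)ᶜ, g i := by
  rw [← sum_add_sum_compl {u, v}, sum_pair h]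

theorem add_sum_le_half_sum_sum (h : u ≠ v) (f : V → V → ℝ) (hf : ∀ i j, 0 ≤ f i j)
    (hs : ∀ i j, f i j = f j i) :
    f u v + ∑ z ∈ ({u, v} : Finset V)ᶜ, (f u z + f v z) ≤ (∑ i, ∑ j, f i j) / 2 := by
  have hrow : ∑ z ∈ ({u, v} : Finset V)ᶜ, (f u z + f v z) ≤
      ∑ i ∈ ({u, v} : Finset V)ᶜ, ∑ j, f i j := by
    refine sum_le_sum fun z _ => ?_
    rw [sum_eq_add_add_sum_compl_pair h, hs u z, hs v z]
    exact le_add_of_nonneg_right (sum_nonneg fun i _ => hf z i)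
  rw [sum_eq_add_add_sum_compl_pair h, sum_eq_add_add_sum_compl_pair h (f u),
    sum_eq_add_add_sum_compl_pair h (f v), hs v u]
  rw [sum_add_distrib] at *
  linarith [hf u u, hf v v]

theorem sum_compl_pair_adjMatrix (h : G.Adj u v) :
    ∑ z ∈ ({u, v} : Finset V)ᶜ, G.adjMatrix ℝ u z = G.degree u - 1 := by
  have hsum := sum_eq_add_add_sum_compl_pair h.ne (G.adjMatrix ℝ u)
  simp only [SimpleGraph.adjMatrix_apply, SimpleGraph.irrefl, h, if_true, if_false,
    ← G.degree_eq_sum_if_adj] at hsum ⊢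
  linarith

theorem sum_compl_pair_adjMatrix_mul_le (h : G.Adj u v) :
    ∑ z ∈ ({u, v} : Finset V)ᶜ, G.adjMatrix ℝ u z * G.adjMatrix ℝ v z ≤ G.degree v - 1 := by
  rw [← sum_compl_pair_adjMatrix h.symm, pair_comm]
  refine sum_le_sum fun z _ => ?_
  simp only [SimpleGraph.adjMatrix_apply]
  split_ifs <;> norm_num

theorem le_shiftedLaplacianForm_self_of_adj (h : G.Adj u v) (a : ℝ) (x : V → ℝ) :
    (x u - x v) ^ 2 - a * (x u ^ 2 + x v ^ 2) + ∑ z ∈ ({u, v} : Finset V)ᶜ,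
      (G.adjMatrix ℝ u z * (x u - x z) ^ 2 + G.adjMatrix ℝ v z * (x v - x z) ^ 2
        - a * x z ^ 2) ≤ shiftedLaplacianForm G a x x := by
  have henergy := add_sum_le_half_sum_sum h.ne
    (fun i j => if G.Adj i j then (x i - x j) ^ 2 else 0)
    (fun i j => by positivity)
    (fun i j => by simp only [G.adj_comm i j, sub_sq_comm])
  rw [shiftedLaplacianForm_self, sum_eq_add_add_sum_compl_pair h.ne fun i => x i ^ 2,
    sum_sub_distrib, ← mul_sum]
  simp only [h, if_true] at henergy
  simp only [SimpleGraph.adjMatrix_apply, ite_mul, one_mul, zero_mul]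
  linarith

theorem star_energy_lower_bound {d α β y p q : ℝ} (hd : 1 < d) (hp : p = 0 ∨ p = 1)
    (hq : q = 0 ∨ q = 1) (hy : (d - 1) * y = -(p * α + q * β)) :
    d * (p * α ^ 2 + q * β ^ 2) - p * q * (α - β) ^ 2 ≤
      (d - 1) * (p * (α - y) ^ 2 + q * (β - y) ^ 2 - d * y ^ 2) := by
  have hy0 : 0 ≤ (d - 1) * y ^ 2 := mul_nonneg (sub_nonneg.2 hd.le) (sq_nonneg y)
  have hy2 : ((d - 1) * y) ^ 2 = (p * α + q * β) ^ 2 := by rw [hy, neg_sq]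
  rcases hp with rfl | rfl <;> rcases hq with rfl | rfl
  · nlinarith
  · linear_combination hy2 + 2 * β * hy
  · linear_combination hy2 + 2 * α * hy
  · linear_combination hy2 + 2 * (α + β) * hy + hy0 + sq_nonneg α + sq_nonneg β

theorem shiftedLaplacianForm_degree_self_nonneg (huv : G.Adj u v) (hv : 2 ≤ G.degree v)
    (hle : G.degree v ≤ G.degree u) {x : V → ℝ}
    (hx : ∀ z, z ≠ u → z ≠ v →
      ((G.degree v : ℝ) - 1) * x z = -(G.adjMatrix ℝ u z * x u + G.adjMatrix ℝ v z * x v)) :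
    0 ≤ shiftedLaplacianForm G (G.degree v) x x := by
  set d : ℝ := (G.degree v : ℝ)
  set D : ℝ := (G.degree u : ℝ)
  set p : V → ℝ := G.adjMatrix ℝ u
  set q : V → ℝ := G.adjMatrix ℝ v
  set S : Finset V := {u, v}ᶜ with hS
  have hd : 1 < d := Nat.one_lt_cast.2 hv
  have hD : d ≤ D := Nat.cast_le.2 hle
  have hcodegree : 0 ≤ d - 1 - ∑ z ∈ S, p z * q z :=
    sub_nonneg.2 (sum_compl_pair_adjMatrix_mul_le huv)
  have hlocal : ∑ z ∈ S, (d * (p z * x u ^ 2 + q z * x v ^ 2) - p z * q z * (x u - x v) ^ 2) ≤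
      ∑ z ∈ S, (d - 1) * (p z * (x u - x z) ^ 2 + q z * (x v - x z) ^ 2 - d * x z ^ 2) := by
    refine sum_le_sum fun z hz => ?_
    obtain ⟨hzu, hzv⟩ : z ≠ u ∧ z ≠ v := by simpa [hS] using hz
    refine star_energy_lower_bound hd ?_ ?_ (hx z hzu hzv) <;>
      simp [p, q, SimpleGraph.adjMatrix_apply, em']
  have hqS : ∑ z ∈ S, q z = d - 1 := by
    rw [hS, pair_comm]
    exact sum_compl_pair_adjMatrix huv.symm
  rw [sum_sub_distrib, ← mul_sum, sum_add_distrib, ← sum_mul, ← sum_mul, ← sum_mul, ← mul_sum,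
    sum_compl_pair_adjMatrix huv, hqS] at hlocal
  have hform := mul_le_mul_of_nonneg_left (le_shiftedLaplacianForm_self_of_adj huv d x)
    (sub_nonneg.2 hd.le)
  have hexcess : 0 ≤ d * (D - d) * x u ^ 2 :=
    mul_nonneg (mul_nonneg (by linarith) (sub_nonneg.2 hD)) (sq_nonneg _)
  refine (mul_nonneg_iff_of_pos_left (sub_pos.2 hd)).1 ?_
  linarith [mul_nonneg hcodegree (sq_nonneg (x u - x v))]

/-- The plane of vectors testing an edge `uv`, with values `z.1` at `u` and `z.2` at `v`. The value
at a vertex adjacent to exactly one of `u`, `v` is the one maximising the contribution of that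
vertex to the form of `L(G) - deg v`. -/
noncomputable def edgeTestMap (G : SimpleGraph V) [DecidableRel G.Adj] (u v : V) :
    ℝ × ℝ →ₗ[ℝ] V → ℝ :=
  LinearMap.pi fun w =>
    if w = u then LinearMap.fst ℝ ℝ ℝ else if w = v then LinearMap.snd ℝ ℝ ℝ
    else -(((G.degree v : ℝ) - 1)⁻¹ • (G.adjMatrix ℝ u w • LinearMap.fst ℝ ℝ ℝ +
      G.adjMatrix ℝ v w • LinearMap.snd ℝ ℝ ℝ))

theorem degree_le_laplacianEigenvalue_two_of_adj (huv : G.Adj u v) (hv : 2 ≤ G.degree v)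
    (hle : G.degree v ≤ G.degree u) : (G.degree v : ℝ) ≤ laplacianEigenvalue G 2 := by
  by_contra! hlt
  have hV : 2 ≤ Fintype.card V := Fintype.one_lt_card_iff.2 ⟨u, v, huv.ne⟩
  obtain ⟨z, hz, hform⟩ := exists_ne_zero_shiftedLaplacianForm_nonpos (G := G) one_le_two hV le_rfl
    (edgeTestMap G u v) (by simp)
  set x := edgeTestMap G u v z
  have hxu : x u = z.1 := by simp [x, edgeTestMap]
  have hxv : x v = z.2 := by simp [x, edgeTestMap, huv.ne']
  have hd : (1 : ℝ) < G.degree v := Nat.one_lt_cast.2 hv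
  have hnonneg : 0 ≤ shiftedLaplacianForm G (G.degree v) x x := by
    refine shiftedLaplacianForm_degree_self_nonneg huv hv hle fun w hwu hwv => ?_
    rw [hxu, hxv]
    simp only [x, edgeTestMap, hwu, hwv, LinearMap.pi_apply, if_false, LinearMap.neg_apply,
      LinearMap.smul_apply, LinearMap.add_apply, LinearMap.fst_apply, LinearMap.snd_apply,
      smul_eq_mul]
    rw [mul_neg, mul_inv_cancel_left₀ (sub_pos.2 hd).ne']
  have hx : 0 < ∑ w, x w ^ 2 := by
    refine (sum_nonneg fun w _ => sq_nonneg (x w)).lt_of_ne' fun h0 => hz ?_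
    rw [sum_eq_zero_iff_of_nonneg fun w _ => sq_nonneg (x w)] at h0
    exact Prod.ext (by simpa [hxu] using h0 u (mem_univ u))
      (by simpa [hxv] using h0 v (mem_univ v))
  rw [shiftedLaplacianForm_self] at hform hnonneg
  linarith [mul_lt_mul_of_pos_right hlt hx]

theorem min_degree_le_laplacianEigenvalue_two (hne : u ≠ v) (hu : 2 ≤ G.degree u)
    (hv : 2 ≤ G.degree v) :
    (min (G.degree u) (G.degree v) : ℝ) ≤ laplacianEigenvalue G 2 := by
  by_cases hadj : G.Adj u v
  · rcases le_total (G.degree v) (G.degree u) with hle | hle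
    · exact min_le_of_right_le (degree_le_laplacianEigenvalue_two_of_adj hadj hv hle)
    · exact min_le_of_left_le (degree_le_laplacianEigenvalue_two_of_adj hadj.symm hu hle)
  · rw [min_le_iff, or_iff_not_imp_left, not_le]
    exact degree_le_of_not_adj hne hadj le_rfl

theorem degree_le_of_ne {a : ℝ} (ha : laplacianEigenvalue G 2 ≤ a) (ha1 : 1 ≤ a) (hne : v ≠ u)
    (hu : a < G.degree u) : (G.degree v : ℝ) ≤ a := by
  by_contra! hv
  have two_le : ∀ w, a < G.degree w → 2 ≤ G.degree w := fun w hw =>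
    Nat.one_lt_cast.1 (ha1.trans_lt hw)
  exact absurd (lt_min hv hu) (not_lt.2
    ((min_degree_le_laplacianEigenvalue_two hne (two_le v hv) (two_le u hu)).trans ha))

end TwoLargeDegrees

section Counting

open Finset

variable {V : Type*} [Fintype V] {G : SimpleGraph V} [DecidableRel G.Adj] {u : V} {k : ℕ}

theorem card_le_card_of_neighbors_subset (hk : 2 ≤ k) {F T : Finset V}
    (hF : ∀ v ∈ F, k ≤ G.degree v) (hT : ∀ w ∈ T, G.degree w < k)
    (hFT : ∀ v ∈ F, ∀ w, G.Adj v w → w ≠ u → w ∈ T) : #F ≤ #T := by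
  classical
  refine Nat.le_of_mul_le_mul_right (card_mul_le_card_mul G.Adj (m := k - 1) (n := k - 1)
    (fun v hv => ?_) fun w hw => ?_) (by omega)
  · have hsub : (G.neighborFinset v).erase u ⊆ bipartiteAbove G.Adj T v := fun w hw => by
      rw [mem_erase, SimpleGraph.mem_neighborFinset] at hw
      exact mem_bipartiteAbove _ |>.2 ⟨hFT v hv w hw.2 hw.1, hw.2⟩
    calc k - 1 ≤ #(G.neighborFinset v) - 1 := Nat.sub_le_sub_right (hF v hv) 1
      _ ≤ #((G.neighborFinset v).erase u) := pred_card_le_card_erase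
      _ ≤ _ := card_le_card hsub
  · have hsub : bipartiteBelow G.Adj F w ⊆ G.neighborFinset w := fun v hv => by
      simpa using (mem_bipartiteBelow _ |>.1 hv).2.symm
    exact (card_le_card hsub).trans (Nat.le_sub_one_of_lt (hT w hw))

variable [DecidableEq V]

/-- The total amount by which the vertices other than `u` fall short of degree `k`; the subtraction
truncates, so a vertex of degree above `k` contributes `0`. -/
def degreeDeficit (G : SimpleGraph V) [DecidableRel G.Adj] (u : V) (k : ℕ) : ℕ :=
  ∑ v ∈ univ.erase u, (k - G.degree v)

theorem sum_degree_add_degreeDeficit (hdeg : ∀ v, v ≠ u → G.degree v ≤ k) :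
    ∑ v, G.degree v + degreeDeficit G u k = G.degree u + (Fintype.card V - 1) * k := by
  rw [← add_sum_erase _ _ (mem_univ u), degreeDeficit, add_assoc, ← sum_add_distrib,
    sum_congr rfl fun v hv => Nat.add_sub_of_le (hdeg v (ne_of_mem_erase hv)), sum_const,
    card_erase_of_mem (mem_univ u), card_univ, smul_eq_mul]

theorem mul_card_sub_one_le_two_mul_degreeDeficit (hk : 2 ≤ k)
    (hdeg : ∀ v, v ≠ u → G.degree v ≤ k) {j : ℕ} (hj : 1 ≤ j) (hj2 : j ≤ 2)
    (hadj : ∀ v w, v ≠ u → w ≠ u → G.Adj v w → G.degree v = k → G.degree w + j ≤ k) :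
    j * (Fintype.card V - 1) ≤ 2 * degreeDeficit G u k := by
  set R : Finset V := univ.erase u with hR
  set F := R.filter fun v => G.degree v = k
  set T := R.filter fun v => G.degree v + j ≤ k
  have hFT : #F ≤ #T := by
    refine card_le_card_of_neighbors_subset (G := G) (u := u) hk (fun v hv => ?_) (fun w hw => ?_)
      fun v hv w hvw hwu => ?_
    · exact (mem_filter.1 hv).2.ge
    · have := (mem_filter.1 hw).2
      omega
    · obtain ⟨hvR, hvk⟩ := mem_filter.1 hv
      exact mem_filter.2 ⟨mem_erase.2 ⟨hwu, mem_univ w⟩,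
        hadj v w (ne_of_mem_erase hvR) hwu hvw hvk⟩
  have hpointwise : #R * j + j * #T ≤ 2 * degreeDeficit G u k + j * #F := by
    rw [degreeDeficit, card_filter, card_filter, mul_sum, mul_sum, mul_sum, ← smul_eq_mul,
      ← sum_const, ← sum_add_distrib, ← sum_add_distrib]
    refine sum_le_sum fun v hv => ?_
    have := hdeg v (ne_of_mem_erase hv)
    split_ifs <;> omega
  rw [hR, card_erase_of_mem (mem_univ u), card_univ] at hpointwise
  linarith [Nat.mul_le_mul_left j hFT]

theorem one_lt_mul_two_sub {n s J : ℕ} (hn : 4 ≤ n) (hs : s < n) (hpos : 0 < s + J) :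
    (1 : ℝ) < (J + (n - 1) * (s / n)) * (2 - 2 * (s / n)) := by
  have hn' : (4 : ℝ) ≤ n := Nat.ofNat_le_cast.2 hn
  rcases Nat.eq_zero_or_pos s with rfl | hs0
  · have hJ : (1 : ℝ) ≤ J := Nat.one_le_cast.2 (by omega)
    norm_num
    linarith
  · have hs1 : (1 : ℝ) ≤ s := Nat.one_le_cast.2 hs0
    have hsn : (s : ℝ) + 1 ≤ n := by exact_mod_cast hs
    have hJ : 0 ≤ (J : ℝ) * (2 * n * (n - s)) :=
      mul_nonneg J.cast_nonneg (mul_nonneg (by linarith) (by linarith))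
    have hprod : (n : ℝ) - 1 ≤ s * (n - s) := by
      linarith [mul_nonneg (sub_nonneg.2 hs1) (by linarith : (0 : ℝ) ≤ n - s - 1)]
    have heq : (J + (n - 1) * (s / n)) * (2 - 2 * (s / n)) =
        (J * (2 * n * (n - s)) + 2 * ((n - 1) * (s * (n - s)))) / (n : ℝ) ^ 2 := by
      field_simp
    rw [heq, one_lt_div (by positivity)]
    nlinarith [mul_le_mul_of_nonneg_left hprod (by linarith : (0 : ℝ) ≤ n - 1)]

theorem one_lt_mul_one_sub {n s J k : ℕ} (hk : 2 ≤ k) (hJ : n - 1 ≤ 2 * J)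
    (hn : k + s + J < n) :
    (1 : ℝ) < (J + (n - 1) * (s / n)) * (1 - 2 * (s / n)) := by
  have hn0 : (1 : ℝ) ≤ n := Nat.one_le_cast.2 (by omega)
  have hs : (5 : ℝ) ≤ n - 2 * s := by
    have : (5 + 2 * s : ℝ) ≤ n := by exact_mod_cast (by omega : 5 + 2 * s ≤ n)
    linarith
  have hJ' : (n : ℝ) ≤ 2 * J + 1 := by exact_mod_cast (by omega : n ≤ 2 * J + 1)
  have hσ : 0 ≤ ((n : ℝ) - 1) * (s / n) := mul_nonneg (by linarith) (by positivity)
  calc (1 : ℝ) < J * (5 / n) := by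
        rw [← mul_div_assoc, one_lt_div (by linarith)]
        linarith [s.cast_nonneg (α := ℝ)]
    _ ≤ J * (1 - 2 * (s / n)) := by
        refine mul_le_mul_of_nonneg_left ?_ J.cast_nonneg
        rw [div_le_iff₀ (by linarith)]
        field_simp
        linarith
    _ ≤ (J + (n - 1) * (s / n)) * (1 - 2 * (s / n)) := by
        refine mul_le_mul_of_nonneg_right (by linarith) ?_
        field_simp
        linarith

end Counting

section LargeDegree

theorem exists_edge_one_lt_mul {V : Type*} [Fintype V] {G : SimpleGraph V} [DecidableRel G.Adj]
    {u : V} {k s : ℕ} (hk : 2 ≤ k) (hs : s < Fintype.card V)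
    (hdeg : ∀ v, v ≠ u → G.degree v ≤ k) (hu : k < G.degree u)
    (hsum : ∑ v, G.degree v = Fintype.card V * k + s) :
    ∃ v w, v ≠ u ∧ w ≠ u ∧ G.Adj v w ∧ 1 < (G.degree u - (k + s / Fintype.card V : ℝ)) *
      (G.degree v + G.degree w + 2 - 2 * (k + s / Fintype.card V)) := by
  classical
  by_contra! hedge
  set n := Fintype.card V with hn
  set J := degreeDeficit G u k
  have hdegu : G.degree u = k + s + J := by
    have h := sum_degree_add_degreeDeficit hdeg
    rw [hsum, ← hn, Nat.sub_one_mul] at h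
    have := Nat.le_mul_of_pos_left k (by omega : 0 < n)
    omega
  have hun : k + s + J < n := hdegu ▸ G.degree_lt_card_verts u
  have hexcess : (G.degree u - (k + s / n) : ℝ) = J + (n - 1) * (s / n) := by
    have : (n : ℝ) ≠ 0 := Nat.cast_ne_zero.2 (by omega)
    rw [hdegu]
    push_cast
    field_simp
    ring
  rw [hexcess] at hedge
  have hadj_one : ∀ v w, v ≠ u → w ≠ u → G.Adj v w → G.degree v = k → G.degree w + 1 ≤ k := by
    intro v w hv hw hvw hvk
    refine Nat.lt_of_le_of_ne (hdeg w hw) fun hwk => ?_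
    have h := hedge v w hv hw hvw
    rw [hvk, hwk] at h
    refine absurd (one_lt_mul_two_sub (by omega) hs (by omega : 0 < s + J)) (not_lt.2 ?_)
    linarith
  have hJ : n - 1 ≤ 2 * J :=
    one_mul (n - 1) ▸ mul_card_sub_one_le_two_mul_degreeDeficit hk hdeg le_rfl one_le_two hadj_one
  have hadj_two : ∀ v w, v ≠ u → w ≠ u → G.Adj v w → G.degree v = k → G.degree w + 2 ≤ k := by
    intro v w hv hw hvw hvk
    refine Nat.lt_of_le_of_ne (hadj_one v w hv hw hvw hvk) fun hwk => ?_
    have h := hedge v w hv hw hvw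
    rw [hvk, ← hwk] at h
    push_cast at h
    refine absurd (one_lt_mul_one_sub hk hJ hun) (not_lt.2 ?_)
    linarith
  have := mul_card_sub_one_le_two_mul_degreeDeficit hk hdeg one_le_two le_rfl hadj_two
  omega

end LargeDegree

section CompleteBipartite

theorem nonempty_iso_completeBipartiteGraph {V α β : Type*} {G : SimpleGraph V} {p : V → Prop}
    (eα : {v // p v} ≃ α) (eβ : {v // ¬ p v} ≃ β)
    (hadj : ∀ v w, G.Adj v w ↔ (p v ↔ ¬ p w)) :
    Nonempty (G ≃g completeBipartiteGraph α β) := by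
  classical
  let e : V ≃ {v // p v} ⊕ {v // ¬ p v} := (Equiv.sumCompl p).symm
  have hleft : ∀ v, (e v).isLeft ↔ p v := fun v => by
    by_cases hv : p v <;>
      simp [e, hv, Equiv.sumCompl_symm_apply_of_pos, Equiv.sumCompl_symm_apply_of_neg]
  have hright : ∀ v, (e v).isRight ↔ ¬ p v := fun v => by
    rw [← hleft v]
    cases e v <;> simp
  let φ : G ≃g completeBipartiteGraph {v // p v} {v // ¬ p v} :=
    ⟨e, fun {v w} => by
      rw [completeBipartiteGraph_adj, hadj, hleft, hleft, hright, hright]; tauto⟩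
  exact ⟨φ.trans (SimpleGraph.completeBipartiteGraphCongr eα eβ)⟩

theorem nonempty_iso_star {V : Type*} [Fintype V] {G : SimpleGraph V} [DecidableRel G.Adj]
    {u : V} (hconn : G.Connected) (hdeg : ∀ v, v ≠ u → G.degree v ≤ 1) :
    Nonempty (G ≃g completeBipartiteGraph (Fin 1) (Fin (Fintype.card V - 1))) := by
  classical
  have hunique : ∀ {v w₁ w₂}, v ≠ u → G.Adj v w₁ → G.Adj v w₂ → w₁ = w₂ := fun hv h₁ h₂ =>
    Finset.card_le_one.1 (hdeg _ hv) _ (by simpa using h₁) _ (by simpa using h₂)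
  have hu : ∀ v, v = u ∨ G.Adj u v := fun v => by
    induction (SimpleGraph.reachable_iff_reflTransGen u v).1 (hconn.preconnected u v) with
    | refl => exact Or.inl rfl
    | @tail b c _ hbc ih =>
      rcases ih with rfl | hub
      · exact Or.inr hbc
      · exact Or.inl (hunique hub.ne' hbc hub.symm)
  refine nonempty_iso_completeBipartiteGraph (p := (· = u))
    (Fintype.equivFinOfCardEq (by simp)) (Fintype.equivFinOfCardEq ?_) fun v w => ?_
  · rw [Fintype.card_subtype_compl, Fintype.card_subtype_eq]
  · constructor
    · intro h
      constructor
      · rintro rfl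
        exact h.ne'
      · intro hw
        by_contra hv
        exact hw (hunique hv h ((hu v).resolve_left hv).symm)
    · intro h
      by_cases hv : v = u
      · exact hv ▸ (hu w).resolve_left (h.1 hv)
      · exact (not_not.1 (mt h.2 hv)) ▸ ((hu v).resolve_left hv).symm

variable {V : Type*} [Fintype V] {G : SimpleGraph V} {h : ℕ}

theorem sum_eq_sum_inl_add_sum_inr {α β M : Type*} [Fintype α] [Fintype β] [AddCommMonoid M]
    (φ : G ≃g completeBipartiteGraph α β) (f : V → M) :
    ∑ v, f v = ∑ i, f (φ.symm (Sum.inl i)) + ∑ i, f (φ.symm (Sum.inr i)) := by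
  rw [← φ.symm.toEquiv.sum_comp, Fintype.sum_sum_type]
  rfl

variable [DecidableRel G.Adj]

theorem isRegularOfDegree_of_iso_completeBipartiteGraph
    (φ : G ≃g completeBipartiteGraph (Fin h) (Fin h)) : G.IsRegularOfDegree h := fun v => by
  obtain ⟨x, rfl⟩ := φ.symm.surjective v
  have hdeg := G.degree_eq_sum_if_adj (R := ℕ) (φ.symm x)
  rw [sum_eq_sum_inl_add_sum_inr φ] at hdeg
  simp only [φ.symm.map_adj_iff, completeBipartiteGraph_adj] at hdeg
  cases x <;> simpa using hdeg

variable [DecidableEq V]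

theorem shiftedLaplacianForm_self_of_iso_completeBipartiteGraph
    (φ : G ≃g completeBipartiteGraph (Fin h) (Fin h)) (x : V → ℝ) :
    shiftedLaplacianForm G h x x =
      -2 * (∑ i, x (φ.symm (Sum.inl i))) * ∑ i, x (φ.symm (Sum.inr i)) := by
  rw [shiftedLaplacianForm_self]
  simp only [sum_eq_sum_inl_add_sum_inr φ, φ.symm.map_adj_iff, completeBipartiteGraph_adj,
    Sum.isLeft_inl, Sum.isRight_inl, Sum.isLeft_inr, Sum.isRight_inr]
  simp [sub_sq, Finset.sum_add_distrib, Finset.sum_sub_distrib, ← Finset.mul_sum,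
    ← Finset.sum_mul]
  ring

theorem laplacianEigenvalue_two_of_iso_completeBipartiteGraph (hh : 2 ≤ h)
    (φ : G ≃g completeBipartiteGraph (Fin h) (Fin h)) : laplacianEigenvalue G 2 = h := by
  have : NeZero h := ⟨by omega⟩
  have hne : φ.symm (Sum.inl 0) ≠ φ.symm (Sum.inr 0) := φ.symm.injective.ne (by simp)
  have hdeg := (isRegularOfDegree_of_iso_completeBipartiteGraph φ).degree_eq
  apply le_antisymm
  · refine laplacianEigenvalue_le_of_shiftedLaplacianForm_nonpos one_le_two
      (Fintype.one_lt_card_iff.2 ⟨_, _, hne⟩)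
      (∑ i, LinearMap.proj (φ.symm (Sum.inl i)) - ∑ i, LinearMap.proj (φ.symm (Sum.inr i)) :
        (V → ℝ) →ₗ[ℝ] ℝ) (by simp) fun x hx => ?_
    have hsums : ∑ i, x (φ.symm (Sum.inl i)) = ∑ i, x (φ.symm (Sum.inr i)) := by
      simpa [sub_eq_zero] using hx
    rw [shiftedLaplacianForm_self_of_iso_completeBipartiteGraph φ, hsums, mul_assoc]
    exact mul_nonpos_of_nonpos_of_nonneg (by norm_num) (mul_self_nonneg _)
  · have hmin := min_degree_le_laplacianEigenvalue_two hne (by rwa [hdeg]) (by rwa [hdeg])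
    rwa [hdeg, hdeg, min_self] at hmin

theorem adj_iff_not_adj_of_isRegularOfDegree {d : ℕ} (hreg : G.IsRegularOfDegree d)
    (hd : laplacianEigenvalue G 2 ≤ d) {p q r s : V} (hpq : G.Adj p q) (hrs : G.Adj r s) :
    G.Adj q r ↔ ¬ G.Adj p r := by
  have h4 := four_le_sq_of_adj_of_adj hreg hd hpq hrs
  simp only [SimpleGraph.adjMatrix_apply] at h4
  constructor
  · intro hqr hpr
    rw [if_pos hpr, if_pos hqr] at h4
    split_ifs at h4 <;> norm_num at h4
  · intro hpr
    by_contra hqr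
    rw [if_neg hpr, if_neg hqr] at h4
    split_ifs at h4 <;> norm_num at h4

theorem card_eq_and_nonempty_iso_of_isRegularOfDegree [Nonempty V] {d : ℕ}
    (hreg : G.IsRegularOfDegree d) (hd0 : 0 < d) (hd : laplacianEigenvalue G 2 ≤ d) :
    Fintype.card V = d + d ∧ Nonempty (G ≃g completeBipartiteGraph (Fin d) (Fin d)) := by
  have hnbr : ∀ v, ∃ w, G.Adj v w := fun v =>
    (G.degree_pos_iff_exists_adj v).1 (hreg.degree_eq v ▸ hd0)
  obtain ⟨x⟩ := ‹Nonempty V›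
  obtain ⟨y, hxy⟩ := hnbr x
  have hcompl : ∀ {p q}, G.Adj p q → ∀ v, G.Adj q v ↔ ¬ G.Adj p v := fun hpq v => by
    obtain ⟨w, hvw⟩ := hnbr v
    exact adj_iff_not_adj_of_isRegularOfDegree hreg hd hpq hvw
  have hadj : ∀ v w, G.Adj v w ↔ (G.Adj x v ↔ ¬ G.Adj x w) := fun v w => by
    by_cases hxv : G.Adj x v
    · simp [hcompl hxv w, hxv]
    · simp [hcompl ((hcompl hxy v).2 hxv) w, hcompl hxy w, hxv]
  have hcard : ∀ v, Fintype.card {w // G.Adj v w} = d := fun v => by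
    rw [Fintype.card_subtype, ← G.neighborFinset_eq_filter, G.card_neighborFinset_eq_degree,
      hreg.degree_eq]
  have hcard' : Fintype.card {w // ¬ G.Adj x w} = d := by
    rw [← hcard y]
    exact Fintype.card_congr (Equiv.subtypeEquivRight fun w => (hcompl hxy w).symm)
  refine ⟨?_, nonempty_iso_completeBipartiteGraph (Fintype.equivFinOfCardEq (hcard x))
    (Fintype.equivFinOfCardEq hcard') hadj⟩
  rw [← Fintype.card_congr (Equiv.sumCompl (G.Adj x)), Fintype.card_sum, hcard, hcard']

end CompleteBipartite

section AverageDegree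

variable {V : Type*} [Fintype V] {G : SimpleGraph V}

theorem nontrivial_of_not_star (hconn : G.Connected)
    (hstar : ¬ Nonempty (G ≃g completeBipartiteGraph (Fin 1) (Fin (Fintype.card V - 1)))) :
    Nontrivial V := by
  classical
  obtain ⟨u⟩ := hconn.nonempty
  exact not_subsingleton_iff_nontrivial.1 fun _ =>
    hstar (nonempty_iso_star hconn fun v hv => absurd (Subsingleton.elim v u) hv)

variable [DecidableRel G.Adj]

theorem one_le_average_degree [Nontrivial V] (hconn : G.Connected) :
    (1 : ℝ) ≤ (∑ v, G.degree v : ℕ) / Fintype.card V := by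
  rw [one_le_div (Nat.cast_pos.2 Fintype.card_pos), Nat.cast_le]
  simpa using Finset.card_nsmul_le_sum Finset.univ (fun v => G.degree v) 1 fun v _ =>
    hconn.preconnected.degree_pos_of_nontrivial v

theorem exists_isRegularOfDegree_of_degree_le_average [Nonempty V]
    (hdeg : ∀ u, (G.degree u : ℝ) ≤ (∑ v, G.degree v : ℕ) / Fintype.card V) :
    ∃ d : ℕ, G.IsRegularOfDegree d ∧ (d : ℝ) = (∑ v, G.degree v : ℕ) / Fintype.card V := by
  have hsum : ∑ u, (G.degree u : ℝ) =
      ∑ _u : V, ((∑ v, G.degree v : ℕ) / Fintype.card V : ℝ) := by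
    rw [Finset.sum_const, Finset.card_univ, nsmul_eq_mul, mul_div_cancel₀ _ (by positivity),
      Nat.cast_sum]
  have heq : ∀ u, (G.degree u : ℝ) = (∑ v, G.degree v : ℕ) / Fintype.card V := fun u =>
    (Finset.sum_eq_sum_iff_of_le fun v _ => hdeg v).1 hsum u (Finset.mem_univ u)
  obtain ⟨u⟩ := ‹Nonempty V›
  exact ⟨G.degree u, fun v => Nat.cast_injective ((heq v).trans (heq u).symm), heq u⟩

variable [DecidableEq V]

theorem degree_le_average_degree [Nontrivial V] (hconn : G.Connected)
    (hstar : ¬ Nonempty (G ≃g completeBipartiteGraph (Fin 1) (Fin (Fintype.card V - 1))))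
    (hμ : laplacianEigenvalue G 2 ≤ (∑ v, G.degree v : ℕ) / Fintype.card V) (u : V) :
    (G.degree u : ℝ) ≤ (∑ v, G.degree v : ℕ) / Fintype.card V := by
  by_contra! hu
  set n := Fintype.card V
  set M := ∑ v, G.degree v
  have hn : 0 < n := Fintype.card_pos
  have haverage : (M / n : ℝ) = (M / n : ℕ) + (M % n : ℕ) / n := by
    have : (n : ℝ) ≠ 0 := by positivity
    field_simp
    exact_mod_cast (Nat.div_add_mod M n).symm
  have hdeg : ∀ v, v ≠ u → G.degree v ≤ M / n := fun v hv => by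
    rw [← Nat.floor_div_eq_div (K := ℝ)]
    exact Nat.le_floor (degree_le_of_ne hμ (one_le_average_degree hconn) hv hu)
  have htwo : 2 ≤ M / n := by
    by_contra hlt
    exact hstar (nonempty_iso_star hconn fun v hv => (hdeg v hv).trans (by omega))
  have hfloor : M / n < G.degree u := by
    rw [← Nat.cast_lt (α := ℝ)]
    exact Nat.cast_div_le.trans_lt hu
  obtain ⟨v, w, hv, hw, hvw, hlt⟩ := exists_edge_one_lt_mul htwo (Nat.mod_lt M hn) hdeg hfloor
    (Nat.div_add_mod M n).symm
  rw [← haverage] at hlt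
  exact hlt.not_ge (degree_sub_mul_edge_degree_le_one hv hw hvw hμ hu)

theorem even_card_and_nonempty_iso_of_laplacianEigenvalue_two_le [Nontrivial V]
    (hconn : G.Connected)
    (hstar : ¬ Nonempty (G ≃g completeBipartiteGraph (Fin 1) (Fin (Fintype.card V - 1))))
    (hμ : laplacianEigenvalue G 2 ≤ (∑ v, G.degree v : ℕ) / Fintype.card V) :
    Even (Fintype.card V) ∧ Nonempty (G ≃g completeBipartiteGraph (Fin (Fintype.card V / 2))
      (Fin (Fintype.card V / 2))) := by
  obtain ⟨d, hreg, hd⟩ := exists_isRegularOfDegree_of_degree_le_average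
    (degree_le_average_degree hconn hstar hμ)
  have hd0 : 0 < d := Nat.cast_pos.1 (one_pos.trans_le (hd ▸ one_le_average_degree hconn))
  obtain ⟨hcard, hiso⟩ := card_eq_and_nonempty_iso_of_isRegularOfDegree hreg hd0 (hd ▸ hμ)
  have hhalf : Fintype.card V / 2 = d := by omega
  exact ⟨⟨d, hcard⟩, by rwa [hhalf]⟩

theorem laplacianEigenvalue_two_eq_average_of_iso [Nonempty V]
    (hstar : ¬ Nonempty (G ≃g completeBipartiteGraph (Fin 1) (Fin (Fintype.card V - 1))))
    (hiso : Even (Fintype.card V) ∧ Nonempty (G ≃g completeBipartiteGraph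
      (Fin (Fintype.card V / 2)) (Fin (Fintype.card V / 2)))) :
    laplacianEigenvalue G 2 = (∑ v, G.degree v : ℕ) / Fintype.card V := by
  obtain ⟨⟨h, hcard⟩, hφ⟩ := hiso
  have hhalf : Fintype.card V / 2 = h := by omega
  rw [hhalf] at hφ
  have h_ne_one : h ≠ 1 := by
    rintro rfl
    exact hstar (by rwa [hcard])
  have hh : 2 ≤ h := by
    have := Fintype.card_pos (α := V)
    omega
  obtain ⟨φ⟩ := hφ
  simp [laplacianEigenvalue_two_of_iso_completeBipartiteGraph hh φ,
    (isRegularOfDegree_of_iso_completeBipartiteGraph φ).degree_eq]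

end AverageDegree

theorem theorem3p4 {V : Type*} [Fintype V] [DecidableEq V]
    (G : SimpleGraph V) [DecidableRel G.Adj] (n m : ℕ)
    (hn : Fintype.card V = n) (hm : G.edgeFinset.card = m)
    (hconn : G.Connected)
    (hstar : ¬ Nonempty (G ≃g completeBipartiteGraph (Fin 1) (Fin (n - 1)))) :
    (2 * m / n : ℝ) ≤ laplacianEigenvalue G 2 ∧
      (laplacianEigenvalue G 2 = (2 * m / n : ℝ) ↔
        Even n ∧ Nonempty (G ≃g completeBipartiteGraph (Fin (n / 2)) (Fin (n / 2)))) := by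
  subst hn hm
  have : Nontrivial V := nontrivial_of_not_star hconn hstar
  have hsum : (2 * G.edgeFinset.card : ℝ) = (∑ v, G.degree v : ℕ) := by
    rw [G.sum_degrees_eq_twice_card_edges, Nat.cast_mul, Nat.cast_two]
  rw [hsum]
  have hiso := even_card_and_nonempty_iso_of_laplacianEigenvalue_two_le hconn hstar
  have heq := laplacianEigenvalue_two_eq_average_of_iso hstar
  refine ⟨?_, fun hμ => hiso hμ.le, heq⟩
  by_contra! hlt
  exact hlt.ne (heq (hiso hlt.le))
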